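/- A \emph{stem extension} of a finite group $G$ is a surjective group homomorphism $\pi:\hat G\to G$ with $\ker\pi\subseteq Z(\hat G)\cap[\hat G,\hat G]$; a \emph{Schur cover} of $G$ is a stem extension $\pi:\tilde G\to G$ for which $|\tilde G|$ is maximal. Given a Schur cover $\pi:\tilde G\to G$, the \emph{deep commuting graph} $\Delta_D(G)$ is the simple graph with vertex set $G$ in which two distinct elements $g,h$ are adjacent if and only if their preimages commute in $\tilde G$, i.e. $xy=yx$ for all $x\in\pi^{-1}(g)$ and $y\in\pi^{-1}(h)$. For a graph $\Gamma$, the \emph{reduced graph} $\Gamma^*$ is the subgraph induced on the vertices of $\Gamma$ that are not adjacent to all other vertices. Let $n\ge 6$ be an integer, let $S_n$ be the symmetric group on $n$ letters, and form $\Delta_D(S_n)$ with any Schur cover of $S_n$. Then $\Delta_D(S_n)^*$ is connected if and only if neither $n$ nor $n-1$ is prime. Moreover, suppose that $\Delta_D(S_n)^*$ is disconnected. Then: (i) if $n$ is prime, then $\Delta_D(S_n)^*$ has exactly $(n-2)!+1$ connected components; (ii) if $n-1$ is prime, then $\Delta_D(S_n)^*$ has exactly $n\,(n-3)!+1$ connected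 components. -/

import Mathlib

universe u v

namespace DeepCommuting

/-- A group homomorphism `π : E →* G` is a stem extension of `G`: it is surjective and its kernel
is contained in the intersection of the centre and the derived subgroup of `E`. -/
structure IsStemExtension {E : Type u} {G : Type v} [Group E] [Group G] (π : E →* G) : Prop where
  surjective : Function.Surjective π
  ker_le_center : π.ker ≤ Subgroup.center E
  ker_le_commutator : π.ker ≤ commutator E

/-- `π : E →* G` is a Schur cover of the finite group `G`: a stem extension of maximal order.
(Every stem extension of a finite group is finite, and every finite group has a copy in each
universe, so comparing with the finite `E'` in the universe of `E` is no restriction.) -/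
structure IsSchurCover {E : Type u} {G : Type v} [Group E] [Group G] (π : E →* G) : Prop where
  finite : Finite E
  isStemExtension : IsStemExtension π
  card_le : ∀ (E' : Type u) [Group E'] [Finite E'] (π' : E' →* G),
    IsStemExtension π' → Nat.card E' ≤ Nat.card E

/-- The deep commuting graph of `G` computed in the Schur cover `π : E →* G`: two distinct
elements of `G` are adjacent if their preimages commute in `E`. -/
def deepCommutingGraph {E : Type u} {G : Type v} [Group E] [Group G] (π : E →* G) :
    SimpleGraph G where
  Adj g h := g ≠ h ∧ ∀ x y : E, π x = g → π y = h → x * y = y * x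
  symm := ⟨fun _ _ hgh => ⟨hgh.1.symm, fun x y hx hy => (hgh.2 y x hy hx).symm⟩⟩
  loopless := ⟨fun _ h => h.1 rfl⟩

/-- The reduced graph `Γ*`: the subgraph induced on the vertices that are not dominant, i.e. not
adjacent to all other vertices. -/
abbrev reducedGraph {V : Type v} (Γ : SimpleGraph V) :
    SimpleGraph ((Γ.universalVertsᶜ : Set V)) :=
  Γ.induce Γ.universalVertsᶜ

/-- The order of a stem extension of a finite group is bounded. -/
theorem exists_card_bound (G : Type v) [Group G] [Finite G] :
    ∃ B : ℕ, ∀ (E : Type u) [Group E] [Finite E] (π : E →* G),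
      IsStemExtension π → Nat.card E ≤ B := by
  refine ⟨(Finset.range (Nat.card (G × G) + 1)).sup Subgroup.cardCommutatorBound * Nat.card G, ?_⟩
  intro E _ _ π hπ
  obtain ⟨s, hs⟩ := hπ.surjective.hasRightInverse
  have hsub : commutatorSet E ⊆ Set.range (fun p : G × G => s p.1 * s p.2 * (s p.2 * s p.1)⁻¹) := by
    rintro _ ⟨x, y, rfl⟩
    refine ⟨(π x, π y), ?_⟩
    have hk : ∀ x : E, (s (π x))⁻¹ * x ∈ Subgroup.center E := fun x =>
      hπ.ker_le_center (by rw [MonoidHom.mem_ker, map_mul, map_inv, hs (π x)]; simp)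
    obtain ⟨a, ha⟩ : ∃ a, a = (s (π x))⁻¹ * x := ⟨_, rfl⟩
    obtain ⟨b, hb⟩ : ∃ b, b = (s (π y))⁻¹ * y := ⟨_, rfl⟩
    have hac := hk x
    have hbc := hk y
    rw [← ha] at hac
    rw [← hb] at hbc
    rw [Subgroup.mem_center_iff] at hac hbc
    have hx : x = s (π x) * a := by rw [ha]; group
    have hy : y = s (π y) * b := by rw [hb]; group
    have h1 : x * y = s (π x) * s (π y) * (a * b) := by
      calc x * y = s (π x) * a * (s (π y) * b) := by rw [← hx, ← hy]
        _ = s (π x) * s (π y) * (a * b) := by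
          rw [mul_assoc, ← mul_assoc a _ b, ← hac (s (π y))]; group
    have h2 : y * x = s (π y) * s (π x) * (a * b) := by
      calc y * x = s (π y) * b * (s (π x) * a) := by rw [← hx, ← hy]
        _ = s (π y) * s (π x) * (a * b) := by
          rw [mul_assoc, ← mul_assoc b _ a, ← hbc (s (π x)), mul_assoc _ b a, ← hbc a]; group
    have h3 : x * y * x⁻¹ * y⁻¹ = x * y * (y * x)⁻¹ := by group
    rw [commutatorElement_def, h3, h1, h2]
    group
  have hcard : Nat.card (commutatorSet E) ≤ Nat.card (G × G) :=
    (Nat.card_mono (Set.finite_range _) hsub).trans (Finite.card_range_le _)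
  have h1 := Subgroup.card_commutator_le_of_finite_commutatorSet E
  have h2 : Nat.card π.ker ≤ Nat.card (commutator E) :=
    Nat.card_mono (Set.toFinite _) hπ.ker_le_commutator
  have h3 : Subgroup.cardCommutatorBound (Nat.card (commutatorSet E)) ≤
      (Finset.range (Nat.card (G × G) + 1)).sup Subgroup.cardCommutatorBound :=
    Finset.le_sup (f := Subgroup.cardCommutatorBound) (Finset.mem_range.2 (by omega))
  have h4 : Nat.card E = Nat.card π.ker * Nat.card G := by
    rw [← π.ker.card_mul_index, Subgroup.index_ker, MonoidHom.range_eq_top.2 hπ.surjective]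
    simp
  rw [h4]
  exact Nat.mul_le_mul_right _ (h2.trans (h1.trans h3))

/-- Every finite group has a Schur cover. -/
theorem exists_isSchurCover (G : Type u) [Group G] [Finite G] :
    ∃ (E : Type u) (_ : Group E) (π : E →* G), IsSchurCover π := by
  obtain ⟨B, hB⟩ := exists_card_bound.{u, u} G
  let P : ℕ → Prop := fun m => ∃ (E : Type u) (_ : Group E) (_ : Finite E) (π : E →* G),
    IsStemExtension π ∧ Nat.card E = m
  have hid : IsStemExtension (MonoidHom.id G) := by
    have hk : (MonoidHom.id G).ker = ⊥ := (MonoidHom.ker_eq_bot_iff _).2 fun _ _ h => h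
    exact ⟨fun g => ⟨g, rfl⟩, hk ▸ bot_le, hk ▸ bot_le⟩
  have h0 : P (Nat.card G) := ⟨G, inferInstance, inferInstance, MonoidHom.id G, hid, rfl⟩
  classical
  have hbd : ∀ m, P m → m ≤ B := by
    rintro m ⟨E, _, _, π, hπ, rfl⟩
    exact hB E π hπ
  obtain ⟨E, iE, iF, π, hπ, hc⟩ := Nat.findGreatest_spec (hbd _ h0) h0
  refine ⟨E, iE, π, iF, hπ, fun E' _ _ π' hπ' => ?_⟩
  have hP : P (Nat.card E') := ⟨E', inferInstance, inferInstance, π', hπ', rfl⟩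
  rw [hc]
  exact Nat.le_findGreatest (hbd _ hP) hP

end DeepCommuting

/-! As the kernel of `π` is central, the commutator of preimages of `g` and `h` depends only on `g`
and `h`; when `g` and `h` commute it is central and bilinear where defined. It therefore vanishes
for coprime orders, and conjugating by elements that commute with `h` gives further vanishing. So
adjacency can be decided inside the symmetric group, without computing the cover.

All transpositions lie in one component: two that share a point are both linked to a 3-cycle on
three other points. Every nontrivial `g` is adjacent to each of its distinct powers of prime order.
Involutions reach the transpositions (`linked_swap_of_sq_eq_one`), and so do elements of odd prime
order (`linked_swap_of_odd_prime`), except a single cycle of prime length `q` fixing at most one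
point. Such a cycle generates its own centralizer, so its component consists of the `q - 1`
nontrivial elements of the group it generates. Dividing the number of `q`-cycles by `q - 1` counts
these components; the one containing the transpositions adds 1. -/

namespace DeepCommuting

open scoped commutatorElement

/-! ### Commutators of preimages in a central extension -/

section CentralExtension

variable {E : Type u} {G : Type v} [Group E] [Group G] {π : E →* G}

/-- All preimages of `g` commute with all preimages of `h`. -/
def DeepCommute (π : E →* G) (g h : G) : Prop :=
  ∀ x y : E, π x = g → π y = h → x * y = y * x

theorem DeepCommute.commute (hs : Function.Surjective π) {g h : G} (H : DeepCommute π g h) :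
    Commute g h := by
  obtain ⟨x, rfl⟩ := hs g
  obtain ⟨y, rfl⟩ := hs h
  exact (show Commute x y from H x y rfl rfl).map π

theorem mem_center_of_map_eq (hk : π.ker ≤ Subgroup.center E) {x x' : E} (h : π x = π x') :
    x⁻¹ * x' ∈ Subgroup.center E :=
  hk (by rw [MonoidHom.mem_ker, map_mul, map_inv, h, inv_mul_cancel])

/-- The commutator of two elements depends only on their images modulo a central kernel. -/
theorem commutatorElement_eq_of_map_eq (hk : π.ker ≤ Subgroup.center E) {x x' y y' : E}
    (hx : π x = π x') (hy : π y = π y') : ⁅x, y⁆ = ⁅x', y'⁆ := by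
  have ha := Subgroup.mem_center_iff.1 (mem_center_of_map_eq hk hx)
  have hb := Subgroup.mem_center_iff.1 (mem_center_of_map_eq hk hy)
  obtain ⟨a, rfl⟩ : ∃ a, x' = x * a := ⟨x⁻¹ * x', by group⟩
  obtain ⟨b, rfl⟩ : ∃ b, y' = y * b := ⟨y⁻¹ * y', by group⟩
  simp only [inv_mul_cancel_left] at ha hb
  have h1 : x * a * (y * b) = x * y * (a * b) := by
    rw [mul_assoc, ← mul_assoc a, ← ha y]; group
  have h2 : y * b * (x * a) = y * x * (a * b) := by
    rw [mul_assoc, ← mul_assoc b, ← hb x, hb a]; group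
  have h3 : ∀ u w : E, ⁅u, w⁆ = u * w * (w * u)⁻¹ := fun u w => by
    rw [commutatorElement_def]; group
  rw [h3, h3, h1, h2]
  group

theorem deepCommute_of_lifts (hk : π.ker ≤ Subgroup.center E) {x y : E} (h : ⁅x, y⁆ = 1) :
    DeepCommute π (π x) (π y) := fun x' y' hx hy => by
  rw [← commutatorElement_eq_one_iff_mul_comm, commutatorElement_eq_of_map_eq hk hx hy, h]

theorem deepCommute_one_left (hk : π.ker ≤ Subgroup.center E) (h : G) : DeepCommute π 1 h :=
  fun _ y hx _ => (Subgroup.mem_center_iff.1 (hk (MonoidHom.mem_ker.2 hx)) y).symm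

theorem deepCommute_zpow (hs : Function.Surjective π) (hk : π.ker ≤ Subgroup.center E)
    (g : G) (m : ℤ) : DeepCommute π g (g ^ m) := by
  obtain ⟨x, rfl⟩ := hs g
  rw [← map_zpow]
  exact deepCommute_of_lifts hk
    (commutatorElement_eq_one_iff_commute.2 ((Commute.refl x).zpow_right m))

theorem DeepCommute.mul_right (hs : Function.Surjective π) (hk : π.ker ≤ Subgroup.center E)
    {g h k : G} (H : DeepCommute π g h) (K : DeepCommute π g k) : DeepCommute π g (h * k) := by
  obtain ⟨x, rfl⟩ := hs g
  obtain ⟨y, rfl⟩ := hs h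
  obtain ⟨z, rfl⟩ := hs k
  rw [← map_mul]
  have hy : Commute x y := H x y rfl rfl
  have hz : Commute x z := K x z rfl rfl
  exact deepCommute_of_lifts hk (commutatorElement_eq_one_iff_commute.2 (hy.mul_right hz))

theorem commutatorElement_mem_center (hk : π.ker ≤ Subgroup.center E) {x y : E}
    (h : Commute (π x) (π y)) : ⁅x, y⁆ ∈ Subgroup.center E :=
  hk (by rw [MonoidHom.mem_ker, map_commutatorElement]
         exact commutatorElement_eq_one_iff_commute.2 h)

/-- In general `⁅x * x', y⁆ = x * ⁅x', y⁆ * x⁻¹ * ⁅x, y⁆`, and here the inner commutator is central.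
-/
theorem commutatorElement_mul_left_of_commute (hk : π.ker ≤ Subgroup.center E) {x x' y : E}
    (h : Commute (π x') (π y)) : ⁅x * x', y⁆ = ⁅x, y⁆ * ⁅x', y⁆ := by
  have hc := Subgroup.mem_center_iff.1 (commutatorElement_mem_center hk h)
  have h1 : ⁅x * x', y⁆ = x * ⁅x', y⁆ * (y * x⁻¹ * y⁻¹) := by
    simp only [commutatorElement_def]; group
  rw [h1, hc x, mul_assoc, ← hc]
  simp only [commutatorElement_def]; group

theorem commutatorElement_pow_left_of_commute (hk : π.ker ≤ Subgroup.center E) {x y : E}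
    (h : Commute (π x) (π y)) (m : ℕ) : ⁅x ^ m, y⁆ = ⁅x, y⁆ ^ m := by
  induction m with
  | zero => simp
  | succ m ih => rw [pow_succ, commutatorElement_mul_left_of_commute hk h, ih, pow_succ]

/-- The element `x ^ orderOf (π x)` lies in the kernel, hence is central, and the exponent comes out
of the commutator. -/
theorem commutatorElement_pow_orderOf (hk : π.ker ≤ Subgroup.center E) {x y : E}
    (h : Commute (π x) (π y)) : ⁅x, y⁆ ^ orderOf (π x) = 1 := by
  rw [← commutatorElement_pow_left_of_commute hk h, commutatorElement_eq_one_iff_mul_comm]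
  exact (Subgroup.mem_center_iff.1 (hk (by
    rw [MonoidHom.mem_ker, map_pow, pow_orderOf_eq_one])) y).symm

/-- Commuting elements of coprime orders have commuting preimages. -/
theorem deepCommute_of_coprime (hs : Function.Surjective π) (hk : π.ker ≤ Subgroup.center E)
    {g h : G} (hc : Commute g h) (ho : (orderOf g).Coprime (orderOf h)) : DeepCommute π g h := by
  obtain ⟨x, rfl⟩ := hs g
  obtain ⟨y, rfl⟩ := hs h
  refine deepCommute_of_lifts hk ?_
  have h1 := commutatorElement_pow_orderOf hk hc
  have h2 := commutatorElement_pow_orderOf hk hc.symm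
  rw [← commutatorElement_inv x y, inv_pow, inv_eq_one] at h2
  rw [← orderOf_eq_one_iff]
  exact Nat.eq_one_of_dvd_coprimes ho (orderOf_dvd_of_pow_eq_one h1) (orderOf_dvd_of_pow_eq_one h2)

/-- Conjugating `g` to `g'` by an element that commutes with `h` does not change the commutator
of preimages. -/
theorem commutatorElement_eq_of_conj (hs : Function.Surjective π)
    (hk : π.ker ≤ Subgroup.center E) {x x' y : E} (h : Commute (π x) (π y)) {t : G}
    (ht : t * π x * t⁻¹ = π x') (hty : Commute t (π y)) : ⁅x, y⁆ = ⁅x', y⁆ := by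
  obtain ⟨t, rfl⟩ := hs t
  have hc := Subgroup.mem_center_iff.1 (commutatorElement_mem_center hk h)
  have h1 : ⁅t * x * t⁻¹, t * y * t⁻¹⁆ = t * ⁅x, y⁆ * t⁻¹ := by
    simp only [commutatorElement_def]; group
  rw [hc t, mul_inv_cancel_right] at h1
  rw [← h1]
  refine commutatorElement_eq_of_map_eq hk (by simpa using ht) ?_
  rw [map_mul, map_mul, map_inv, hty.eq, mul_inv_cancel_right]

/-- If `g` has odd order and is inverted by an element commuting with `h`, then preimages of `g`
and `h` commute. -/
theorem deepCommute_of_conj_inv (hs : Function.Surjective π) (hk : π.ker ≤ Subgroup.center E)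
    {g h t : G} (hc : Commute g h) (ho : Odd (orderOf g)) (ht : t * g * t⁻¹ = g⁻¹)
    (hth : Commute t h) : DeepCommute π g h := by
  obtain ⟨x, rfl⟩ := hs g
  obtain ⟨y, rfl⟩ := hs h
  refine deepCommute_of_lifts hk ?_
  have h1 := commutatorElement_eq_of_conj hs hk hc (x' := x⁻¹) (by simpa using ht) hth
  -- Expanding `⁅x⁻¹ * x, y⁆ = 1` with both factors equal shows that `⁅x, y⁆` squares to 1; its
  -- order also divides the odd order of `g`.
  have h2 := commutatorElement_mul_left_of_commute hk (x := x⁻¹) hc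
  rw [inv_mul_cancel, commutatorElement_one_left, ← h1, ← pow_two] at h2
  have h3 := commutatorElement_pow_orderOf hk hc
  rw [← orderOf_eq_one_iff]
  exact Nat.eq_one_of_dvd_coprimes ho.coprime_two_left
    (orderOf_dvd_of_pow_eq_one h2.symm) (orderOf_dvd_of_pow_eq_one h3)

/-- If `s` is an involution commuting with `h` and `s'` is its conjugate by an element commuting
with `h`, then preimages of `s * s'` and `h` commute. -/
theorem deepCommute_mul_conj (hs : Function.Surjective π) (hk : π.ker ≤ Subgroup.center E)
    {s s' h t : G} (hc : Commute s h) (ho : s ^ 2 = 1) (ht : t * s * t⁻¹ = s')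
    (hth : Commute t h) : DeepCommute π (s * s') h := by
  have hc' : Commute s' h := ht ▸ (hth.mul_left hc).mul_left hth.inv_left
  obtain ⟨x, rfl⟩ := hs s
  obtain ⟨x', rfl⟩ := hs s'
  obtain ⟨y, rfl⟩ := hs h
  rw [← map_mul]
  refine deepCommute_of_lifts hk ?_
  rw [commutatorElement_mul_left_of_commute hk hc', ← commutatorElement_eq_of_conj hs hk hc ht hth,
    ← pow_two, ← orderOf_dvd_iff_pow_eq_one]
  exact (orderOf_dvd_of_pow_eq_one (commutatorElement_pow_orderOf hk hc)).trans
    (orderOf_dvd_of_pow_eq_one ho)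

end CentralExtension

/-! ### Permutations and dominant vertices -/

section Perm

open Equiv Equiv.Perm Finset

section Linked

variable {E : Type u} {α : Type v} [Group E] {π : E →* Perm α}

/-- `g` and `h` are vertices of the reduced deep commuting graph in the same component. -/
def Linked (π : E →* Perm α) (g h : Perm α) : Prop :=
  ∃ (hg : g ∈ (deepCommutingGraph π).universalVertsᶜ)
    (hh : h ∈ (deepCommutingGraph π).universalVertsᶜ),
    (reducedGraph (deepCommutingGraph π)).Reachable ⟨g, hg⟩ ⟨h, hh⟩

theorem Linked.symm {g h : Perm α} : Linked π g h → Linked π h g :=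
  fun ⟨hg, hh, H⟩ => ⟨hh, hg, H.symm⟩

theorem Linked.trans {g h k : Perm α} : Linked π g h → Linked π h k → Linked π g k :=
  fun ⟨hg, _, H⟩ ⟨_, hk, K⟩ => ⟨hg, hk, H.trans K⟩

theorem swap_ne_one [DecidableEq α] {a b : α} (h : a ≠ b) : swap a b ≠ 1 := fun e => h (swap_eq_one_iff.1 e)

end Linked

variable {E : Type u} {α : Type v} [Group E] [Fintype α] [DecidableEq α] {π : E →* Perm α}

theorem exists_not_commute {g : Perm α} (hα : 3 ≤ Fintype.card α) (hg : g ≠ 1) :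
    ∃ h, ¬ Commute g h := by
  obtain ⟨a, ha⟩ := DFunLike.ne_iff.1 hg
  rw [one_apply] at ha
  obtain ⟨c, hc⟩ : ∃ c, c ∉ ({a, g a} : Finset α) := by
    by_contra! H
    have h1 := card_le_card (show (univ : Finset α) ⊆ {a, g a} from fun c _ => H c)
    have h2 := card_le_two (a := a) (b := g a)
    rw [card_univ] at h1
    omega
  simp only [mem_insert, mem_singleton, not_or] at hc
  -- This transposition fixes `a` but moves `g a`, so the two products differ at `a`.
  refine ⟨swap (g a) c, fun H => ?_⟩
  have h1 := DFunLike.congr_fun H.eq a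
  rw [mul_apply, mul_apply, swap_apply_left, swap_apply_of_ne_of_ne (Ne.symm ha) (Ne.symm hc.1)]
    at h1
  exact hc.2 h1.symm

/-- The only dominant vertex of the deep commuting graph is the identity. -/
theorem mem_compl_universalVerts (hs : Function.Surjective π) (hk : π.ker ≤ Subgroup.center E)
    (hα : 3 ≤ Fintype.card α) {g : Perm α} :
    g ∈ (deepCommutingGraph π).universalVertsᶜ ↔ g ≠ 1 := by
  constructor
  · rintro h rfl
    exact h fun w hw => ⟨hw, deepCommute_one_left hk w⟩
  · intro hg H
    obtain ⟨h, hh⟩ := exists_not_commute hα hg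
    have hne : g ≠ h := fun e => hh (e ▸ Commute.refl _)
    exact hh (DeepCommute.commute hs (H hne).2)

theorem DeepCommute.linked (hs : Function.Surjective π) (hk : π.ker ≤ Subgroup.center E)
    (hα : 3 ≤ Fintype.card α) {g h : Perm α} (hg : g ≠ 1) (hh : h ≠ 1) (H : DeepCommute π g h) :
    Linked π g h := by
  refine ⟨(mem_compl_universalVerts hs hk hα).2 hg, (mem_compl_universalVerts hs hk hα).2 hh, ?_⟩
  by_cases e : g = h
  · subst e; rfl
  · exact SimpleGraph.Adj.reachable ⟨e, H⟩

theorem exists_three_notMem (s : Finset α) (h : s.card + 3 ≤ Fintype.card α) :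
    ∃ a b c, a ∉ s ∧ b ∉ s ∧ c ∉ s ∧ a ≠ b ∧ a ≠ c ∧ b ≠ c := by
  have : 2 < sᶜ.card := by rw [card_compl]; omega
  simpa only [mem_compl] using two_lt_card_iff.1 this

theorem exists_two_notMem (s : Finset α) (h : s.card + 2 ≤ Fintype.card α) :
    ∃ a b, a ∉ s ∧ b ∉ s ∧ a ≠ b := by
  have : 1 < sᶜ.card := by rw [card_compl]; omega
  simpa only [mem_compl] using one_lt_card_iff.1 this

theorem support_swap_mul_swap_same_subset (a b c : α) :
    (swap a b * swap a c).support ⊆ {a, b, c} := by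
  intro x hx
  by_contra H
  simp only [mem_insert, mem_singleton, not_or] at H
  rw [mem_support, mul_apply, swap_apply_of_ne_of_ne H.1 H.2.2,
    swap_apply_of_ne_of_ne H.1 H.2.1] at hx
  exact hx rfl

theorem disjoint_of_support_subset {g h : Perm α} {s : Finset α} (hg : g.support ⊆ s)
    (hs : ∀ x ∈ s, h x = x) : Perm.Disjoint g h := fun x => by
  by_cases hx : x ∈ s
  · exact Or.inr (hs x hx)
  · exact Or.inl (notMem_support.1 fun h => hx (hg h))

/-- A permutation is conjugate to its inverse by a permutation supported on its support. -/
theorem exists_conj_inv (c : Perm α) :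
    ∃ t : Perm α, t * c * t⁻¹ = c⁻¹ ∧ t.support ⊆ c.support := by
  let c' : Perm {x // x ∈ c.support} := c.subtypePerm (fun x => apply_mem_support)
  have hcc : ofSubtype c' = c :=
    ofSubtype_subtypePerm (fun x => apply_mem_support) fun x hx => mem_support.2 hx
  obtain ⟨t, ht⟩ := isConj_iff.1 (isConj_iff_cycleType_eq.2 (cycleType_inv c').symm)
  refine ⟨ofSubtype t, ?_, ?_⟩
  · have h := congrArg ofSubtype ht
    rwa [map_mul, map_mul, map_inv, map_inv, hcc] at h
  · intro x hx
    by_contra H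
    exact mem_support.1 hx (ofSubtype_apply_of_not_mem t H)

/-! ### Paths to the transpositions -/

section Linking

variable (hs : Function.Surjective π) (hk : π.ker ≤ Subgroup.center E)
  (hα : 6 ≤ Fintype.card α)
include hs hk hα

theorem linked_of_coprime {g h : Perm α} (hg : g ≠ 1) (hh : h ≠ 1) (hc : Commute g h)
    (ho : (orderOf g).Coprime (orderOf h)) : Linked π g h :=
  (deepCommute_of_coprime hs hk hc ho).linked hs hk (by omega) hg hh

/-- An element of odd order with two fixed points is linked to a transposition. -/
theorem linked_swap_of_fixed {g : Perm α} (hg : g ≠ 1) (ho : Odd (orderOf g)) {a b : α}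
    (hab : a ≠ b) (ha : g a = a) (hb : g b = b) : Linked π g (swap a b) := by
  refine linked_of_coprime hs hk hα hg (swap_ne_one hab) ?_ ?_
  · refine (disjoint_of_support_subset (s := {a, b}) (support_swap hab).subset ?_).symm.commute
    simp [ha, hb]
  · rw [orderOf_eq_prime (pow_two (swap a b) ▸ swap_mul_self a b) (swap_ne_one hab)]
    exact ho.coprime_two_right

/-- A 3-cycle on three points outside `{a, b, c}` fixes all of these and has order prime to 2, so it
is linked to both transpositions. This is where six points are needed. -/
theorem linked_swap_swap_same {a b c : α} (hab : a ≠ b) (hac : a ≠ c) :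
    Linked π (swap a b) (swap a c) := by
  obtain ⟨d, e, f, hd, he, hf, hde, hdf, hef⟩ := exists_three_notMem ({a, b, c} : Finset α)
    (by have := card_le_three (a := a) (b := b) (c := c); omega)
  simp only [mem_insert, mem_singleton, not_or] at hd he hf
  have h3 := isThreeCycle_swap_mul_swap_same hde hdf hef
  have key : ∀ x ∈ ({a, b, c} : Finset α), (swap d e * swap d f) x = x := by
    intro x hx
    refine notMem_support.1 fun h => ?_
    have := support_swap_mul_swap_same_subset d e f h
    simp only [mem_insert, mem_singleton] at hx this
    grind
  have ho : Odd (orderOf (swap d e * swap d f)) := by rw [h3.orderOf]; decide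
  have hne : swap d e * swap d f ≠ 1 := h3.isCycle.ne_one
  exact (linked_swap_of_fixed hs hk hα hne ho hab (key a (by simp)) (key b (by simp))).symm.trans
    (linked_swap_of_fixed hs hk hα hne ho hac (key a (by simp)) (key c (by simp)))

theorem linked_swap_swap {a b c d : α} (hab : a ≠ b) (hcd : c ≠ d) :
    Linked π (swap a b) (swap c d) := by
  by_cases hac : a = c
  · subst hac
    exact linked_swap_swap_same hs hk hα hab hcd
  · refine (linked_swap_swap_same hs hk hα hab hac).trans ?_
    rw [swap_comm a c]
    exact linked_swap_swap_same hs hk hα (Ne.symm hac) hcd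

/-- A permutation of odd prime order is linked to a transposition, unless it is a cycle moving
all points, or all but one. -/
theorem linked_swap_of_odd_prime {g : Perm α} (hp : (orderOf g).Prime) (ho : Odd (orderOf g))
    (h : ¬ (g.IsCycle ∧ Fintype.card α ≤ g.support.card + 1)) {a b : α} (hab : a ≠ b) :
    Linked π g (swap a b) := by
  have main : ∀ c : Perm α, c ≠ 1 → Odd (orderOf c) → c.support.card + 2 ≤ Fintype.card α →
      Linked π c (swap a b) := by
    intro c hc hoc hcard
    obtain ⟨d, e, hd, he, hde⟩ := exists_two_notMem c.support hcard
    exact (linked_swap_of_fixed hs hk hα hc hoc hde (notMem_support.1 hd)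
      (notMem_support.1 he)).trans (linked_swap_swap hs hk hα hde hab)
  have hg : g ≠ 1 := by rintro rfl; simp [Nat.not_prime_one] at hp
  by_cases hcard : g.support.card + 2 ≤ Fintype.card α
  · exact main g hg ho hcard
  have hnc : ¬ g.IsCycle := fun hc => h ⟨hc, by omega⟩
  obtain ⟨c, hc⟩ : g.cycleFactorsFinset.Nonempty := by
    rw [nonempty_iff_ne_empty]
    exact fun e => hg (cycleFactorsFinset_eq_empty_iff.1 e)
  have hcyc := (mem_cycleFactorsFinset_iff.1 hc).1
  have hdis := (disjoint_mul_inv_of_mem_cycleFactorsFinset hc).symm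
  obtain ⟨k, hk'⟩ : ∃ k, k = g * c⁻¹ := ⟨_, rfl⟩
  rw [← hk'] at hdis
  have hgk : g = c * k := by rw [hdis.commute.eq, hk', inv_mul_cancel_right]
  have hk1 : k ≠ 1 := by rintro rfl; rw [mul_one] at hgk; exact hnc (hgk ▸ hcyc)
  have hoc : orderOf c ∣ orderOf g := by
    rw [hgk, hdis.orderOf]; exact Nat.dvd_lcm_left _ _
  have hoc' : Odd (orderOf c) := Odd.of_dvd_nat ho hoc
  -- An element inverting the cycle factor `c` inside its support commutes with the rest `k`, so `c`
  -- deep-commutes with `k` and hence with `g`.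
  obtain ⟨t, ht, hts⟩ := exists_conj_inv c
  have htk : Commute t k :=
    (disjoint_of_support_subset hts fun x hx =>
      (hdis x).resolve_left (mem_support.1 hx)).commute
  have hck : DeepCommute π c k := deepCommute_of_conj_inv hs hk hdis.commute hoc' ht htk
  have hcg : DeepCommute π c g := by
    rw [hgk]
    refine DeepCommute.mul_right hs hk ?_ hck
    simpa using deepCommute_zpow hs hk c 1
  refine (hcg.linked hs hk (by omega) hcyc.ne_one hg).symm.trans (main c hcyc.ne_one hoc' ?_)
  -- Since `k` moves at least two points, `c` fixes at least two.
  have h1 : g.support.card = c.support.card + k.support.card := by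
    rw [hgk, hdis.card_support_mul]
  have h2 := two_le_card_support_of_ne_one hk1
  have h3 := card_le_univ g.support
  omega

/-- Every involution is linked to a transposition. -/
theorem linked_swap_of_sq_eq_one {g : Perm α} (hg : g ≠ 1) (h2 : g ^ 2 = 1) {a b : α}
    (hab : a ≠ b) : Linked π g (swap a b) := by
  have hgg : ∀ x, g (g x) = x := fun x => by
    rw [← mul_apply, ← pow_two, h2, one_apply]
  have ho : orderOf g = 2 := orderOf_eq_prime h2 hg
  -- It suffices to commute with an element of order 3: the orders are coprime, and a 3-cycle is too
  -- short to be exceptional.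
  have main : ∀ h : Perm α, h ≠ 1 → h ^ 3 = 1 → Commute g h → Linked π g (swap a b) := by
    intro h h1 h3 hc
    have ho3 : orderOf h = 3 := orderOf_eq_prime h3 h1
    refine (linked_of_coprime hs hk hα hg h1 hc (by rw [ho, ho3]; decide)).trans
      (linked_swap_of_odd_prime hs hk hα (by rw [ho3]; decide) (by rw [ho3]; decide) ?_ hab)
    rintro ⟨hcyc, hcard⟩
    rw [← hcyc.orderOf, ho3] at hcard
    omega
  by_cases hfix : g.support.card + 3 ≤ Fintype.card α
  · obtain ⟨d, e, f, hd, he, hf, hde, hdf, hef⟩ := exists_three_notMem g.support hfix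
    have h3 := isThreeCycle_swap_mul_swap_same hde hdf hef
    refine main _ h3.isCycle.ne_one (by rw [← h3.orderOf, pow_orderOf_eq_one])
      (disjoint_of_support_subset (support_swap_mul_swap_same_subset d e f) ?_).symm.commute
    rw [notMem_support] at hd he hf
    simp [hd, he, hf]
  obtain ⟨x, hx⟩ : ∃ x, x ∈ g.support := by
    have : 0 < g.support.card := by omega
    exact card_pos.1 this
  obtain ⟨y, hy, hy'⟩ : ∃ y ∈ g.support, y ∉ ({x, g x} : Finset α) := by
    refine exists_mem_notMem_of_card_lt_card ?_
    have := card_le_two (a := x) (b := g x)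
    omega
  -- With three 2-cycles in `g`, a 3-cycle `t` on one point of each has disjoint conjugate `g * t *
  -- g⁻¹`, and their product commutes with `g`.
  by_cases H : ∃ z ∈ g.support, z ∉ ({x, g x, y, g y} : Finset α)
  · obtain ⟨z, hz, hz'⟩ := H
    rw [mem_support] at hx hy hz
    simp only [mem_insert, mem_singleton, not_or] at hy' hz'
    have hgx := hgg x
    have hgy := hgg y
    have hgz := hgg z
    have h3 := isThreeCycle_swap_mul_swap_same (a := x) (b := y) (c := z)
      (by grind) (by grind) (by grind)
    obtain ⟨t, ht⟩ : ∃ t, t = swap x y * swap x z := ⟨_, rfl⟩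
    have hts : t.support ⊆ {x, y, z} := ht ▸ support_swap_mul_swap_same_subset x y z
    rw [← ht] at h3
    have hdis : Perm.Disjoint t (g * t * g⁻¹) := by
      refine disjoint_of_support_subset hts fun w hw => ?_
      have hginv : g⁻¹ w = g w := by rw [inv_eq_iff_eq, hgg]
      rw [mul_apply, mul_apply, hginv]
      have : t (g w) = g w := by
        refine notMem_support.1 fun h => ?_
        have := hts h
        simp only [mem_insert, mem_singleton] at hw this
        grind
      rw [this, hgg]
    have ht3 : t ^ 3 = 1 := by rw [← h3.orderOf, pow_orderOf_eq_one]
    refine main (t * (g * t * g⁻¹)) ?_ ?_ ?_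
    · intro h
      exact h3.isCycle.ne_one (hdis.mul_eq_one_iff.1 h).1
    · rw [hdis.commute.mul_pow, conj_pow, ht3]
      simp
    · have hgi : g⁻¹ = g := by rw [inv_eq_iff_mul_eq_one, ← pow_two, h2]
      have e := hdis.commute.eq
      rw [hgi] at e ⊢
      calc g * (t * (g * t * g)) = g * t * g * t * g := by simp only [mul_assoc]
        _ = t * (g * t * g) * g := by rw [e]
  -- Now `g` is a product of two transpositions, interchanged by an element commuting with a
  -- transposition of two fixed points. Their commutators with the latter are equal and of order
  -- dividing 2, so they cancel.
  · push Not at H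
    have hsub : g.support ⊆ {x, g x, y, g y} := H
    obtain ⟨d, e, hd, he, hde⟩ := exists_two_notMem g.support (by
      have h1 := card_le_card hsub
      have h2 := card_le_four (a := x) (b := g x) (c := y) (d := g y)
      omega)
    rw [mem_support] at hx hy
    rw [notMem_support] at hd he
    simp only [mem_insert, mem_singleton, not_or] at hy'
    have hgx := hgg x
    have hgy := hgg y
    have hgE : g = swap x (g x) * swap y (g y) := by
      ext w
      by_cases hw : w ∈ g.support
      · have := hsub hw
        simp only [mem_insert, mem_singleton] at this
        simp only [mul_apply, swap_apply_def]
        grind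
      · have : w ≠ x ∧ w ≠ g x ∧ w ≠ y ∧ w ≠ g y := by
          rw [notMem_support] at hw
          grind
        rw [mul_apply, swap_apply_of_ne_of_ne this.2.2.1 this.2.2.2,
          swap_apply_of_ne_of_ne this.1 this.2.1, notMem_support.1 hw]
    have hcs : ∀ u v : α, u ∈ g.support → v ∈ g.support → Commute (swap u v) (swap d e) := by
      intro u v hu hv
      rw [mem_support] at hu hv
      have : Perm.Disjoint (swap u v) (swap d e) := fun w => by
        simp only [swap_apply_def]
        grind
      exact this.commute
    have hmx : x ∈ g.support := mem_support.2 hx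
    have hmy : y ∈ g.support := mem_support.2 hy
    have hmgx := apply_mem_support.2 hmx
    have hmgy := apply_mem_support.2 hmy
    have hD : DeepCommute π g (swap d e) := by
      rw [hgE]
      refine deepCommute_mul_conj hs hk (t := swap x y * swap (g x) (g y)) (hcs _ _ hmx hmgx)
        (by rw [pow_two, swap_mul_self]) ?_ ((hcs _ _ hmx hmy).mul_left (hcs _ _ hmgx hmgy))
      rw [← swap_apply_apply]
      congr 1
      · simp only [mul_apply, swap_apply_def]; grind
      · simp only [mul_apply, swap_apply_def]; grind
    exact (hD.linked hs hk (by omega) hg (swap_ne_one hde)).trans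
      (linked_swap_swap hs hk hα hde hab)

end Linking

end Perm

/-! ### Exceptional cycles and counting components -/

section Components

open Equiv Equiv.Perm Finset

variable {E : Type u} {α : Type v} [Group E] [Fintype α] [DecidableEq α] {π : E →* Perm α}

/-- A cycle fixing at most one point generates its own centralizer. -/
theorem mem_zpowers_of_commute {c h : Perm α} (hc : c.IsCycle)
    (hcard : Fintype.card α ≤ c.support.card + 1) (hch : Commute c h) :
    h ∈ Subgroup.zpowers c := by
  have hsupp : ∀ x, x ∈ c.support ↔ h x ∈ c.support := fun x => by
    rw [mem_support, mem_support, ← mul_apply, hch.eq, mul_apply, h.injective.ne_iff]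
  obtain ⟨x, hx, -⟩ := id hc
  -- On the support, `h` and `c ^ i` agree at `x` and commute with `c`, so they agree everywhere;
  -- the at most one remaining point is fixed by both.
  obtain ⟨i, hi⟩ := hc.exists_zpow_eq hx (mem_support.1 ((hsupp x).1 (mem_support.2 hx)))
  refine ⟨i, ?_⟩
  ext y
  dsimp only
  by_cases hy : y ∈ c.support
  · obtain ⟨j, rfl⟩ := hc.exists_zpow_eq hx (mem_support.1 hy)
    rw [← mul_apply, ← mul_apply, ← zpow_add, add_comm, zpow_add, mul_apply, hi, ← mul_apply,
      (hch.zpow_left j).eq]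
  · have hcompl : c.supportᶜ.card ≤ 1 := by rw [card_compl]; omega
    rw [zpow_apply_eq_self_of_apply_eq_self (notMem_support.1 hy)]
    exact card_le_one.1 hcompl y (mem_compl.2 hy) (h y)
      (mem_compl.2 fun H => hy ((hsupp y).2 H))

theorem isCycle_of_orderOf_prime {g : Perm α} (hα : 6 ≤ Fintype.card α) (hp : (orderOf g).Prime)
    (hcard : Fintype.card α ≤ orderOf g + 1) : g.IsCycle :=
  isCycle_of_prime_order hp (by have := card_le_univ g.support; omega)

theorem orderOf_eq_of_mem_zpowers {G : Type*} [Group G] {g h : G} (hp : (orderOf g).Prime)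
    (hh : h ∈ Subgroup.zpowers g) (h1 : h ≠ 1) : orderOf h = orderOf g :=
  (hp.eq_one_or_self_of_dvd _ (orderOf_dvd_of_mem_zpowers hh)).resolve_left
    fun e => h1 (orderOf_eq_one_iff.1 e)

/-- There is no room for two disjoint `q`-cycles, so the elements of order `q` are exactly the
`q`-cycles. -/
theorem card_filter_orderOf_eq (hα : 6 ≤ Fintype.card α) {q : ℕ} (hq : q.Prime)
    (hle : q ≤ Fintype.card α)
    (hcard : Fintype.card α ≤ q + 1) :
    #({g | orderOf g = q} : Finset (Perm α)) = (q - 1).factorial * (Fintype.card α).choose q := by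
  rw [← card_of_cycleType_singleton hq.two_le hle]
  congr 1
  ext g
  simp only [mem_filter, mem_univ, true_and]
  constructor
  · rintro rfl
    have hcyc := isCycle_of_orderOf_prime hα hq hcard
    rw [hcyc.cycleType, ← hcyc.orderOf]
  · intro h
    rw [← lcm_cycleType, h, Multiset.lcm_singleton, normalize_eq]

variable (hs : Function.Surjective π) (hk : π.ker ≤ Subgroup.center E)
  (hα : 6 ≤ Fintype.card α)
include hs hk hα

/-- A nontrivial permutation is linked to the transpositions unless its order is a prime equal
to the degree or to the degree minus one. -/
theorem linked_swap_or_orderOf_prime {g : Perm α} (hg : g ≠ 1) {a b : α} (hab : a ≠ b) :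
    Linked π g (swap a b) ∨ ((orderOf g).Prime ∧ Fintype.card α ≤ orderOf g + 1) := by
  have ho1 : orderOf g ≠ 1 := fun e => hg (orderOf_eq_one_iff.1 e)
  obtain ⟨p, hp, hpd⟩ := Nat.exists_prime_and_dvd ho1
  obtain ⟨g', hg'⟩ : ∃ g', g' = g ^ (orderOf g / p) := ⟨_, rfl⟩
  have hop : orderOf g' = p := by
    rw [hg', orderOf_pow_orderOf_div (orderOf_pos g).ne' hpd]
  have hg1 : g' ≠ 1 := by
    rintro rfl
    rw [orderOf_one] at hop
    exact hp.one_lt.ne hop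
  have hL : Linked π g g' := by
    refine DeepCommute.linked hs hk (by omega) hg hg1 ?_
    rw [hg', ← zpow_natCast]
    exact deepCommute_zpow hs hk g _
  rcases hp.eq_two_or_odd' with rfl | hodd
  · exact Or.inl (hL.trans (linked_swap_of_sq_eq_one hs hk hα hg1
      (by rw [← hop, pow_orderOf_eq_one]) hab))
  by_cases hcyc : g'.IsCycle ∧ Fintype.card α ≤ g'.support.card + 1
  · right
    have hmem : g ∈ Subgroup.zpowers g' :=
      mem_zpowers_of_commute hcyc.1 hcyc.2 (by rw [hg']; exact (Commute.refl g).pow_left _)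
    have e := orderOf_eq_of_mem_zpowers (by rwa [hop]) hmem hg
    refine ⟨by rwa [e, hop], ?_⟩
    rw [e, hcyc.1.orderOf]
    exact hcyc.2
  · exact Or.inl (hL.trans (linked_swap_of_odd_prime hs hk hα (by rwa [hop]) (by rwa [hop])
      hcyc hab))

/-- Along a walk, each vertex in `zpowers g` is again a cycle fixing at most one point, so the next
vertex, which commutes with it, stays in `zpowers g`. -/
theorem Linked.mem_zpowers {g h : Perm α} (hp : (orderOf g).Prime)
    (hcard : Fintype.card α ≤ orderOf g + 1) (H : Linked π g h) : h ∈ Subgroup.zpowers g := by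
  obtain ⟨hg, hh, ⟨w⟩⟩ := H
  suffices key : ∀ (x y : ((deepCommutingGraph π).universalVertsᶜ : Set (Perm α)))
      (_ : (reducedGraph (deepCommutingGraph π)).Walk x y), x.1 ∈ Subgroup.zpowers g →
      y.1 ∈ Subgroup.zpowers g from key _ _ w (Subgroup.mem_zpowers g)
  intro x y w
  induction w with
  | nil => exact id
  | @cons x z y hadj _ ih =>
    intro hx
    apply ih
    have hx1 := (mem_compl_universalVerts hs hk (by omega)).1 x.2
    have ho := orderOf_eq_of_mem_zpowers hp hx hx1
    have hcyc := isCycle_of_orderOf_prime hα (by rwa [ho]) (by rwa [ho])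
    have hzx : z.1 ∈ Subgroup.zpowers x.1 :=
      mem_zpowers_of_commute hcyc (by rwa [← hcyc.orderOf, ho])
        (DeepCommute.commute hs (show DeepCommute π x.1 z.1 from hadj.2))
    exact Subgroup.zpowers_le.2 hx hzx

theorem not_linked_swap {g : Perm α} (hp : (orderOf g).Prime)
    (hcard : Fintype.card α ≤ orderOf g + 1) {a b : α} (hab : a ≠ b) :
    ¬ Linked π g (swap a b) := fun H => by
  have h := orderOf_eq_of_mem_zpowers hp (H.mem_zpowers hs hk hα hp hcard) (swap_ne_one hab)
  rw [orderOf_eq_prime (pow_two (swap a b) ▸ swap_mul_self a b) (swap_ne_one hab)] at h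
  omega

theorem linked_iff_mem_zpowers {g h : Perm α} (hp : (orderOf g).Prime)
    (hcard : Fintype.card α ≤ orderOf g + 1) :
    Linked π g h ↔ h ∈ Subgroup.zpowers g ∧ h ≠ 1 := by
  constructor
  · intro H
    exact ⟨H.mem_zpowers hs hk hα hp hcard,
      (mem_compl_universalVerts hs hk (by omega)).1 H.2.1⟩
  · rintro ⟨⟨i, rfl⟩, h1⟩
    refine (deepCommute_zpow hs hk g i).linked hs hk (by omega) ?_ h1
    rintro rfl
    simp [Nat.not_prime_one] at hp

theorem connected_of_not_prime (h0 : ¬ (Fintype.card α).Prime)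
    (h1 : ¬ (Fintype.card α - 1).Prime) :
    (reducedGraph (deepCommutingGraph π)).Connected := by
  obtain ⟨a, b, hab⟩ := Fintype.one_lt_card_iff.1 (show 1 < Fintype.card α by omega)
  have key : ∀ g : Perm α, g ≠ 1 → Linked π g (swap a b) := by
    intro g hg
    refine (linked_swap_or_orderOf_prime hs hk hα hg hab).resolve_right ?_
    rintro ⟨hp, hcard⟩
    have hle : orderOf g ≤ Fintype.card α := by
      rw [(isCycle_of_orderOf_prime hα hp hcard).orderOf]
      exact card_le_univ _
    rcases (show orderOf g = Fintype.card α ∨ orderOf g = Fintype.card α - 1 by omega) with e | e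
    · exact h0 (e ▸ hp)
    · exact h1 (e ▸ hp)
  have hmem : ∀ {g : Perm α}, g ∈ (deepCommutingGraph π).universalVertsᶜ ↔ g ≠ 1 :=
    mem_compl_universalVerts hs hk (by omega)
  rw [SimpleGraph.connected_iff_exists_forall_reachable]
  refine ⟨⟨swap a b, hmem.2 (swap_ne_one hab)⟩, fun x => ?_⟩
  obtain ⟨_, _, H⟩ := (key x.1 (hmem.1 x.2)).symm
  exact H

/-- The number of components when the degree or the degree minus one is a prime `q`. -/
theorem card_connectedComponent {q : ℕ} (hq : q.Prime) (hle : q ≤ Fintype.card α)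
    (hcard : Fintype.card α ≤ q + 1) :
    Nat.card (reducedGraph (deepCommutingGraph π)).ConnectedComponent =
      (q - 2).factorial * (Fintype.card α).choose q + 1 := by
  classical
  obtain ⟨a, b, hab⟩ := Fintype.one_lt_card_iff.1 (show 1 < Fintype.card α by omega)
  have hmem : ∀ {g : Perm α}, g ∈ (deepCommutingGraph π).universalVertsᶜ ↔ g ≠ 1 :=
    mem_compl_universalVerts hs hk (by omega)
  let Γ := reducedGraph (deepCommutingGraph π)
  let m : Γ.ConnectedComponent := Γ.connectedComponentMk ⟨swap a b, hmem.2 (swap_ne_one hab)⟩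
  -- The default `m` is taken only at the identity, which never enters the count.
  let f : Perm α → Γ.ConnectedComponent := fun g =>
    if hg : g ∈ (deepCommutingGraph π).universalVertsᶜ then Γ.connectedComponentMk ⟨g, hg⟩ else m
  have hf : ∀ g h, g ≠ 1 → h ≠ 1 → (f g = f h ↔ Linked π g h) := by
    intro g h hg hh
    simp only [f, dif_pos (hmem.2 hg), dif_pos (hmem.2 hh), SimpleGraph.ConnectedComponent.eq]
    exact ⟨fun H => ⟨_, _, H⟩, fun ⟨_, _, H⟩ => H⟩
  have hfm : f (swap a b) = m := dif_pos (hmem.2 (swap_ne_one hab))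
  have hne1 : ∀ g : Perm α, orderOf g = q → g ≠ 1 := by
    rintro g h rfl
    rw [orderOf_one] at h
    exact hq.one_lt.ne h
  have : Fintype Γ.ConnectedComponent := Fintype.ofFinite _
  have hmaps : ∀ g ∈ ({g | orderOf g = q} : Finset (Perm α)), f g ∈ univ.erase m := by
    intro g hg
    obtain rfl := (mem_filter.1 hg).2
    refine mem_erase.2 ⟨fun e => ?_, mem_univ _⟩
    rw [← hfm, hf _ _ (hne1 g rfl) (swap_ne_one hab)] at e
    exact not_linked_swap hs hk hα hq hcard hab e
  have hfiber : ∀ k ∈ univ.erase m,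
      #{g ∈ ({g | orderOf g = q} : Finset (Perm α)) | f g = k} = q - 1 := by
    intro k hkm
    obtain ⟨⟨g, hg⟩, rfl⟩ := k.exists_rep
    have hg1 := hmem.1 hg
    have hfg : f g = Γ.connectedComponentMk ⟨g, hg⟩ := dif_pos hg
    have hk' : Quot.mk _ (⟨g, hg⟩ : ((deepCommutingGraph π).universalVertsᶜ : Set (Perm α))) =
      f g := hfg.symm
    rw [hk'] at hkm ⊢
    have hnl : ¬ Linked π g (swap a b) := by
      rw [← hf _ _ hg1 (swap_ne_one hab), hfm]
      exact (mem_erase.1 hkm).1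
    obtain ⟨hp, hc⟩ := (linked_swap_or_orderOf_prime hs hk hα hg1 hab).resolve_left hnl
    have hgle : orderOf g ≤ Fintype.card α := by
      rw [(isCycle_of_orderOf_prime hα hp hc).orderOf]
      exact card_le_univ _
    -- Both are odd primes among the consecutive integers `card α - 1` and `card α`, so they
    -- coincide.
    have hog : orderOf g = q := by
      have h1 := hp.eq_two_or_odd
      have h2 := hq.eq_two_or_odd
      omega
    have : ({h ∈ ({g | orderOf g = q} : Finset (Perm α)) | f h = f g}) =
        ((Subgroup.zpowers g : Set (Perm α)).toFinset).erase 1 := by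
      ext h
      simp only [mem_filter, mem_univ, true_and, mem_erase, Set.mem_toFinset, SetLike.mem_coe]
      constructor
      · rintro ⟨ho, e⟩
        rw [eq_comm, hf _ _ hg1 (hne1 h ho), linked_iff_mem_zpowers hs hk hα hp hc] at e
        exact e.symm
      · rintro ⟨h1, hz⟩
        refine ⟨(orderOf_eq_of_mem_zpowers hp hz h1).trans hog, ?_⟩
        rw [eq_comm, hf _ _ hg1 h1, linked_iff_mem_zpowers hs hk hα hp hc]
        exact ⟨hz, h1⟩
    rw [this, card_erase_of_mem (by simp), Set.toFinset_card]
    congr 1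
    rw [← hog, ← Nat.card_zpowers, Nat.card_eq_fintype_card]
    rfl
  -- Every component other than `m` contains exactly `q - 1` elements of order `q`, so counting
  -- these elements by component yields the number of components.
  have hcount := card_eq_sum_card_fiberwise hmaps
  rw [sum_congr rfl hfiber, sum_const, smul_eq_mul, card_filter_orderOf_eq hα hq hle hcard,
    card_erase_of_mem (mem_univ m), card_univ] at hcount
  rw [Nat.card_eq_fintype_card]
  change Fintype.card Γ.ConnectedComponent = _
  have hpos : 0 < Fintype.card Γ.ConnectedComponent := Fintype.card_pos_iff.2 ⟨m⟩
  have hfac : (q - 1).factorial = (q - 1) * (q - 2).factorial := by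
    rw [← Nat.mul_factorial_pred (show q - 1 ≠ 0 by omega)]
    rfl
  rw [hfac, mul_assoc, mul_comm] at hcount
  have := Nat.eq_of_mul_eq_mul_right (show 0 < q - 1 by omega) hcount
  omega

theorem not_connected_of_prime {q : ℕ} (hq : q.Prime) (hle : q ≤ Fintype.card α)
    (hcard : Fintype.card α ≤ q + 1) : ¬ (reducedGraph (deepCommutingGraph π)).Connected := by
  intro H
  have := H.preconnected.subsingleton_connectedComponent
  have h1 := card_connectedComponent hs hk hα hq hle hcard
  have h2 := Finite.card_le_one_iff_subsingleton.2 this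
  have h3 := Nat.mul_pos (Nat.factorial_pos (q - 2)) (Nat.choose_pos hle)
  omega

end Components

end DeepCommuting

theorem mainTheorem11 (n : ℕ) (hn : 6 ≤ n) {E : Type u} [Group E]
    (π : E →* Equiv.Perm (Fin n)) (hπ : DeepCommuting.IsSchurCover π) :
    ((DeepCommuting.reducedGraph (DeepCommuting.deepCommutingGraph π)).Connected ↔
      ¬ n.Prime ∧ ¬ (n - 1).Prime) ∧
    (¬ (DeepCommuting.reducedGraph (DeepCommuting.deepCommutingGraph π)).Connected →
      (n.Prime →
        Nat.card (DeepCommuting.reducedGraph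
          (DeepCommuting.deepCommutingGraph π)).ConnectedComponent =
            Nat.factorial (n - 2) + 1) ∧
      ((n - 1).Prime →
        Nat.card (DeepCommuting.reducedGraph
          (DeepCommuting.deepCommutingGraph π)).ConnectedComponent =
            n * Nat.factorial (n - 3) + 1)) := by
  have hs := hπ.isStemExtension.surjective
  have hk := hπ.isStemExtension.ker_le_center
  have hcard : Fintype.card (Fin n) = n := Fintype.card_fin n
  have hα : 6 ≤ Fintype.card (Fin n) := by omega
  refine ⟨⟨fun H => ⟨fun hp => ?_, fun hp => ?_⟩, fun H => ?_⟩,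
    fun _ => ⟨fun hp => ?_, fun hp => ?_⟩⟩
  · exact DeepCommuting.not_connected_of_prime hs hk hα hp (by omega) (by omega) H
  · exact DeepCommuting.not_connected_of_prime hs hk hα hp (by omega) (by omega) H
  · exact DeepCommuting.connected_of_not_prime hs hk hα (by rw [hcard]; exact H.1)
      (by rw [hcard]; exact H.2)
  · rw [DeepCommuting.card_connectedComponent hs hk hα hp (by omega) (by omega), hcard,
      Nat.choose_self, mul_one]
  · rw [DeepCommuting.card_connectedComponent hs hk hα hp (by omega) (by omega), hcard,
      Nat.choose_symm (show 1 ≤ n by omega), Nat.choose_one_right, mul_comm, Nat.sub_sub]
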